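/- **Theorem (rapidly decaying class $\mathcal K$ functions).** There are universal constants $C_1,C_2>0$ such that the following holds. *Setting.* Let $f:\mathbb R^d\times\mathbb R^m\to\mathbb R^d$. For a policy $\pi:\mathbb R^d\to\mathbb R^m$, an initial condition $\xi$ and a perturbation sequence $\{\Delta_t\}$, let $x^\pi_t(\xi,\{\Delta_s\})$ be the solution of $x_{t+1}=f(x_t,\pi(x_t)+\Delta_t)$, $x_0=\xi$, and let $x_t^\pi(\xi)$ be the solution with $\Delta\equiv0$. Let $\mathcal X\subset\mathbb R^d$ be compact and let $\mathcal D$ be a probability distribution supported in $\mathcal X$. Let $\pi(x,\theta)$, $x\in\mathbb R^d$, $\theta\in\mathbb R^q$, be twice continuously differentiable with values in $\mathbb R^m$ and $\pi(0,\theta)=0$ for all $\|\theta\|\le B_\theta$, and put $\Pi_{\theta,0}=\{\pi(\cdot,\theta):\|\theta\|\le B_\theta\}$. Let $\pi_\star\in\Pi_{\theta,0}$ be the expert, and let $B_X>0$ satisfy $\|x_t^{\pi_\star}(\xi)\|\le B_X$ for all $t\in\mathbb N$, $\xi\in\mathcal X$. Put $$B_{\ell,0}=2\sup_{\|x\|\le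 B_X,\|\theta\|\le B_\theta}\|\pi(x,\theta)\|,\qquad L_{\ell,0}=B_X\sup_{\|x\|\le B_X,\|\theta\|\le B_\theta}\|\partial_x\partial_\theta\pi(x,\theta)\|,$$ and assume $B_\theta B_{\ell,0}^{-1}L_{\ell,0}\ge1$ (in particular $B_{\ell,0}>0$). For a horizon $T$ let $$\Gamma_T(\xi;\pi)=\max_{1\le t\le T}\|x_t^\pi(\xi)-x_t^{\pi_\star}(\xi)\|,\qquad \ell_0^{\pi_\star}(\xi;\pi)=\max_{0\le t\le T-1}\|\pi(x_t^{\pi_\star}(\xi))-\pi_\star(x_t^{\pi_\star}(\xi))\|.$$ *Assumptions.* There is $L_\pi\ge0$ such that every $\pi\in\Pi_{\theta,0}$ satisfies $\|\pi(x)-\pi(y)\|\le L_\pi\|x-y\|$ for all $x,y$. The expert closed loop is $\eta$-locally $\delta$-ISS for some $\eta>0$: there are $\beta$ of class $\mathcal{KL}$ (continuous, $\beta(\cdot,t)$ of class $\mathcal K$, $\beta(x,\cdot)$ decreasing) and $\gamma$ of class $\mathcal K$ (continuous and strictly increasing on $[0,\infty)$, $\gamma(0)=0$) such that $$\|x_t^{\pi_\star}(\xi_1,\{\Delta_s\})-x_t^{\pi_\star}(\xi_2)\|\le\beta(\|\xi_1-\xi_2\|,t)+\gamma\Big(\max_{0\le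 k\le t-1}\|\Delta_k\|\Big)$$ for all $\xi_1,\xi_2\in\mathcal X$, all $t\in\mathbb N$ and all $\{\Delta_s\}$ with $\sup_s\|\Delta_s\|\le\eta$. Moreover $\gamma(x)=O(x^{1+r})$ as $x\to0^+$ for some $r>0$, and $\mu,\alpha>0$ are constants with $$2L_\pi x+(x/\mu)^{1/(1+r)}\le\gamma^{-1}(x)\quad\text{for all }0\le x\le\alpha$$ (where $\gamma^{-1}(x)=\infty$ if $x$ exceeds all values of $\gamma$), $\alpha/\mu\le1$ and $L_\pi\mu\ge1/2$. *Conclusion.* Let $\xi_1,\dots,\xi_n$ be i.i.d. from $\mathcal D$, let $\hat\pi\in\arg\min_{\pi\in\Pi_{\theta,0}}\frac1n\sum_{i=1}^n\ell_0^{\pi_\star}(\xi_i;\pi)$ be an empirical risk minimizer (chosen measurably in the sample), and let $\delta\in(0,1)$. With $\kappa_\alpha=q(\mu/\alpha)^{1/(1+r)}$ and $\kappa_\eta=qL_\pi\mu/\eta$, suppose $$n\ge C_1\max\Big\{1,\;B_{\ell,0}\tfrac{\kappa_\alpha}{\delta}\log\Big(\tfrac{\kappa_\alpha B_\theta L_{\ell,0}}{\delta}\Big),\;B_{\ell,0}\tfrac{\kappa_\eta}{\delta}\log\Big(\tfrac{\kappa_\eta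 B_\theta L_{\ell,0}}{\delta}\Big)\Big\}.$$ Then, with probability at least $1-\delta$ over $\xi_1,\dots,\xi_n$ and a fresh independent $\xi\sim\mathcal D$, $$\Gamma_T(\xi;\hat\pi)\le C_2\,\mu\left(\frac1\delta\,\frac{B_{\ell,0}\,q\,\log\big(B_\theta B_{\ell,0}^{-1}L_{\ell,0}\,n\big)}{n}\right)^{1+r}.$$ -/

import Mathlib

noncomputable section

namespace ImitationLearning

/-- Euclidean space `ℝᵏ` with the Euclidean norm. -/
abbrev Euc (k : ℕ) : Type := EuclideanSpace ℝ (Fin k)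

/-- The state `x_t^π(ξ, {Δ_s})` of `x_{t+1} = f(x_t, π(x_t) + Δ_t)`, `x_0 = ξ`. -/
def perturbedState {d m : ℕ} (f : Euc d → Euc m → Euc d) (π : Euc d → Euc m)
    (ξ : Euc d) (Δ : ℕ → Euc m) : ℕ → Euc d
  | 0 => ξ
  | t + 1 => f (perturbedState f π ξ Δ t) (π (perturbedState f π ξ Δ t) + Δ t)

/-- The unperturbed state `x_t^π(ξ)`. -/
def state {d m : ℕ} (f : Euc d → Euc m → Euc d) (π : Euc d → Euc m) (ξ : Euc d) (t : ℕ) :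
    Euc d :=
  perturbedState f π ξ (fun _ => 0) t

/-- Class `𝒦` functions on `[0, ∞)`. -/
structure IsClassK (γ : ℝ → ℝ) : Prop where
  continuousOn : ContinuousOn γ (Set.Ici 0)
  strictMonoOn : StrictMonoOn γ (Set.Ici 0)
  map_zero : γ 0 = 0

/-- Class `𝒦ℒ` functions on `[0, ∞) × [0, ∞)`: continuous, of class `𝒦` in the first variable,
decreasing in the second. -/
structure IsClassKL (β : ℝ → ℝ → ℝ) : Prop where
  continuousOn : ContinuousOn (fun p : ℝ × ℝ => β p.1 p.2) (Set.Ici 0 ×ˢ Set.Ici 0)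
  classK : ∀ t, 0 ≤ t → IsClassK (fun x => β x t)
  antitoneOn : ∀ x, 0 ≤ x → AntitoneOn (fun t => β x t) (Set.Ici 0)

/-- The closed-loop system of `f` under `π` is `η`-locally incrementally input-to-state stable on
the set `X` of initial conditions, with gain functions `β` and `γ`. -/
structure IsLocallyDeltaISS {d m : ℕ} (f : Euc d → Euc m → Euc d) (π : Euc d → Euc m)
    (X : Set (Euc d)) (η : ℝ) (β : ℝ → ℝ → ℝ) (γ : ℝ → ℝ) : Prop where
  classKL : IsClassKL β
  classK : IsClassK γ
  bound : ∀ ξ₁ ∈ X, ∀ ξ₂ ∈ X, ∀ Δ : ℕ → Euc m, (∀ s, ‖Δ s‖ ≤ η) → ∀ t : ℕ,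
    ‖perturbedState f π ξ₁ Δ t - state f π ξ₂ t‖ ≤
      β ‖ξ₁ - ξ₂‖ t + γ (⨆ k : Fin t, ‖Δ k‖)

/-- The imitation gap `Γ_T(ξ; π) = max_{1 ≤ t ≤ T} ‖x_t^π(ξ) - x_t^{π⋆}(ξ)‖`. -/
def imitationGap {d m : ℕ} (f : Euc d → Euc m → Euc d) (πstar : Euc d → Euc m) (T : ℕ)
    (ξ : Euc d) (π : Euc d → Euc m) : ℝ :=
  ⨆ t : Fin T, ‖state f π ξ (t + 1) - state f πstar ξ (t + 1)‖

/-- The zeroth-order loss `ℓ_0(ξ; π) = max_{0 ≤ t ≤ T-1} ‖π(x_t) - π⋆(x_t)‖`, evaluated along the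
expert trajectory `x_t = x_t^{π⋆}(ξ)`. -/
def loss {d m : ℕ} (f : Euc d → Euc m → Euc d) (πstar : Euc d → Euc m) (T : ℕ)
    (ξ : Euc d) (π : Euc d → Euc m) : ℝ :=
  ⨆ t : Fin T, ‖π (state f πstar ξ t) - πstar (state f πstar ξ t)‖

/-- The policies `π(·, θ)` with `‖θ‖ ≤ B_θ`. -/
def policyClass {d m q : ℕ} (pol : Euc d → Euc q → Euc m) (Bθ : ℝ) : Set (Euc d → Euc m) :=
  {π | ∃ θ : Euc q, ‖θ‖ ≤ Bθ ∧ π = fun x => pol x θ}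

/-- `π̂` minimizes the empirical risk on the initial conditions `S` over the class `Pi`. -/
def IsERM {d m n : ℕ} (f : Euc d → Euc m → Euc d) (πstar : Euc d → Euc m) (T : ℕ)
    (Pi : Set (Euc d → Euc m)) (S : Fin n → Euc d) (πhat : Euc d → Euc m) : Prop :=
  πhat ∈ Pi ∧ ∀ π ∈ Pi,
    (1 / (n : ℝ)) * ∑ i, loss f πstar T (S i) πhat ≤ (1 / (n : ℝ)) * ∑ i, loss f πstar T (S i) π

/-- `B_0 = sup ‖π(x, θ)‖` over `‖x‖ ≤ B_X`, `‖θ‖ ≤ B_θ`. -/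
def supPolicy {d m q : ℕ} (pol : Euc d → Euc q → Euc m) (BX Bθ : ℝ) : ℝ :=
  sSup {s | ∃ (x : Euc d) (θ : Euc q), ‖x‖ ≤ BX ∧ ‖θ‖ ≤ Bθ ∧ s = ‖pol x θ‖}

/-- `L_0 = sup ‖∂_x ∂_θ π(x, θ)‖` over `‖x‖ ≤ B_X`, `‖θ‖ ≤ B_θ`, with the operator norm of the
mixed derivative as a bilinear map `ℝᵈ × ℝ^q → ℝᵐ`. -/
def supMixedDeriv {d m q : ℕ} (pol : Euc d → Euc q → Euc m) (BX Bθ : ℝ) : ℝ :=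
  sSup {s | ∃ (x : Euc d) (θ : Euc q), ‖x‖ ≤ BX ∧ ‖θ‖ ≤ Bθ ∧
    s = ‖fderiv ℝ (fun x' : Euc d => fderiv ℝ (fun θ' : Euc q => pol x' θ') θ) x‖}

/-- `B_{ℓ,0} = 2 B_0`. -/
def lossBound {d m q : ℕ} (pol : Euc d → Euc q → Euc m) (BX Bθ : ℝ) : ℝ :=
  2 * supPolicy pol BX Bθ

/-- `L_{ℓ,0} = B_X L_0`. -/
def lossLip {d m q : ℕ} (pol : Euc d → Euc q → Euc m) (BX Bθ : ℝ) : ℝ :=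
  BX * supMixedDeriv pol BX Bθ

/-- One term `(B_{ℓ,0} κ / δ) log (κ B_θ L_{ℓ,0} / δ)` of the burn-in requirement. -/
def burnInTerm (Bl Ll Bθ δ κ : ℝ) : ℝ :=
  Bl * (κ / δ) * Real.log (κ * Bθ * Ll / δ)

end ImitationLearning

end

/-! The argument has a deterministic half and a statistical half.

Deterministic (`imitationGap_le`): the learner's closed loop is the expert's, driven by the input
`πhat - πstar` evaluated along the learner's own trajectory. If the two trajectories are within `x`
so far, this input is at most `2 Lπ x + ε`, with `ε` the loss along the expert. For `x = μ ε ^ (1 +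
r)` this is the assumed lower bound for `γ⁻¹(x)`, so δ-ISS keeps the next state within `x` and the
induction closes.

Statistical (`measure_lt_loss_erm_le`): the expert lies in the class, so the minimizer has zero loss
on the sample. Policies are Lipschitz in the parameter (`norm_pol_sub_le`), so a nearby net point
has loss at most `τ / 2` on the sample, yet more than `τ / 2` on any fresh draw where the minimizer
exceeds `τ`. `measure_prod_le_of_avoiding` bounds the joint probability over sample and draw by a
union bound over the net.

The burn-in makes the rate `τ` small enough for the deterministic half to apply. -/

namespace ImitationLearning

open MeasureTheory Metric Module

/-! ### Covering numbers of balls -/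

/-- Volume bound for the size of a separated subset of a ball. -/
theorem card_le_of_separated_closedBall {E : Type*} [NormedAddCommGroup E] [NormedSpace ℝ E]
    [FiniteDimensional ℝ E] {B s : ℝ} (hB : 0 ≤ B) (hs : 0 < s) (t : Finset E)
    (ht : ∀ c ∈ t, ‖c‖ ≤ B) (hsep : ∀ c ∈ t, ∀ d ∈ t, c ≠ d → s ≤ ‖c - d‖) :
    (t.card : ℝ) ≤ (1 + 2 * B / s) ^ finrank ℝ E := by
  borelize E
  let μ : Measure E := Measure.addHaar
  have hs2 : 0 < s / 2 := by positivity
  have hρ : 0 < B + s / 2 := by positivity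
  -- Balls of radius `s / 2` about separated points are disjoint and lie in the ball of radius `B +
  -- s / 2`; compare volumes.
  have hdisj : Set.Pairwise (t : Set E) (Function.onFun Disjoint fun c => ball (c : E) (s / 2)) := by
    rintro c hc d hd hcd
    apply ball_disjoint_ball
    rw [dist_eq_norm]
    linarith [hsep c hc d hd hcd]
  have hsub : (⋃ c ∈ t, ball (c : E) (s / 2)) ⊆ ball (0 : E) (B + s / 2) := by
    refine Set.iUnion₂_subset fun x hx => ball_subset_ball' ?_
    rw [dist_zero_right]
    linarith [ht x hx]
  have hvol : (t.card : ENNReal) * ENNReal.ofReal ((s / 2) ^ finrank ℝ E) * μ (ball 0 1) ≤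
      ENNReal.ofReal ((B + s / 2) ^ finrank ℝ E) * μ (ball 0 1) := by
    calc
      _ = μ (⋃ c ∈ t, ball (c : E) (s / 2)) := by
        rw [measure_biUnion_finset hdisj fun c _ => measurableSet_ball]
        simp only [μ.addHaar_ball_of_pos _ hs2, Finset.sum_const, nsmul_eq_mul, mul_assoc]
      _ ≤ μ (ball (0 : E) (B + s / 2)) := measure_mono hsub
      _ = _ := by rw [μ.addHaar_ball_of_pos _ hρ]
  have hcancel := (ENNReal.mul_le_mul_iff_left
    (measure_ball_pos _ _ zero_lt_one).ne' measure_ball_lt_top.ne).1 hvol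
  have hreal : (t.card : ℝ) * (s / 2) ^ finrank ℝ E ≤ (B + s / 2) ^ finrank ℝ E := by
    have := ENNReal.toReal_le_of_le_ofReal (by positivity) hcancel
    rwa [ENNReal.toReal_mul, ENNReal.toReal_ofReal (by positivity), ENNReal.toReal_natCast] at this
  have hratio : 1 + 2 * B / s = (B + s / 2) / (s / 2) := by field_simp; ring
  rw [hratio, div_pow, le_div_iff₀ (by positivity)]
  exact hreal

/-- A closed ball of radius `B` has an `s`-net with at most `(1 + 2 * B / s) ^ dim` points. -/
theorem exists_net_closedBall (E : Type*) [NormedAddCommGroup E] [NormedSpace ℝ E]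
    [FiniteDimensional ℝ E] {B s : ℝ} (hB : 0 ≤ B) (hs : 0 < s) :
    ∃ t : Finset E, (t.card : ℝ) ≤ (1 + 2 * B / s) ^ finrank ℝ E ∧ (∀ c ∈ t, ‖c‖ ≤ B) ∧
      ∀ x : E, ‖x‖ ≤ B → ∃ c ∈ t, ‖x - c‖ ≤ s := by
  classical
  let cards : Set ℕ := {k | ∃ t : Finset E, t.card = k ∧ (∀ c ∈ t, ‖c‖ ≤ B) ∧
    ∀ c ∈ t, ∀ d ∈ t, c ≠ d → s ≤ ‖c - d‖}
  have hbdd : BddAbove cards := by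
    refine ⟨⌊(1 + 2 * B / s) ^ finrank ℝ E⌋₊, ?_⟩
    rintro k ⟨t, rfl, h1, h2⟩
    exact Nat.le_floor (card_le_of_separated_closedBall hB hs t h1 h2)
  -- A separated set of maximal cardinality is a net: a point far from all of it could be added.
  obtain ⟨t, htcard, ht, hsep⟩ := Nat.sSup_mem (s := cards) ⟨0, ∅, by simp⟩ hbdd
  refine ⟨t, card_le_of_separated_closedBall hB hs t ht hsep, ht, fun x hx => ?_⟩
  by_contra! hfar
  have hxt : x ∉ t := fun h => by
    have := hfar x h
    simp at this
    linarith
  have hmem : (insert x t).card ∈ cards := by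
    refine ⟨insert x t, rfl, ?_, ?_⟩
    · intro c hc
      rcases Finset.mem_insert.1 hc with rfl | hc
      · exact hx
      · exact ht c hc
    · intro c hc e he hne
      rcases Finset.mem_insert.1 hc with h1 | h1 <;> rcases Finset.mem_insert.1 he with h2 | h2
      · exact absurd (h1.trans h2.symm) hne
      · exact h1 ▸ (hfar e h2).le
      · rw [norm_sub_rev]
        exact h2 ▸ (hfar c h1).le
      · exact hsep c h1 e h2 hne
  have := le_csSup hbdd hmem
  rw [Finset.card_insert_of_notMem hxt] at this
  omega

/-! ### Regularity of the policy class in the parameter -/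

variable {d m q : ℕ}

theorem contDiff_fderiv_param {pol : Euc d → Euc q → Euc m}
    (hpol : ContDiff ℝ 2 (fun p : Euc d × Euc q => pol p.1 p.2)) :
    ContDiff ℝ 1 (fun p : Euc d × Euc q => fderiv ℝ (fun θ => pol p.1 θ) p.2) := by
  refine ContDiff.fderiv (m := 2) (f := fun (p : Euc d × Euc q) θ => pol p.1 θ) ?_ contDiff_snd
    (by norm_num)
  exact hpol.comp ((contDiff_fst.comp contDiff_fst).prodMk contDiff_snd)

theorem continuous_mixedDeriv {pol : Euc d → Euc q → Euc m}
    (hpol : ContDiff ℝ 2 (fun p : Euc d × Euc q => pol p.1 p.2)) :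
    Continuous (fun p : Euc d × Euc q =>
      fderiv ℝ (fun x' : Euc d => fderiv ℝ (fun θ' : Euc q => pol x' θ') p.2) p.1) := by
  have h := contDiff_fderiv_param hpol
  have : ContDiff ℝ 0 (fun p : Euc d × Euc q =>
      fderiv ℝ (fun x' : Euc d => fderiv ℝ (fun θ' : Euc q => pol x' θ') p.2) p.1) := by
    refine ContDiff.fderiv (m := 1)
      (f := fun (p : Euc d × Euc q) x' => fderiv ℝ (fun θ' : Euc q => pol x' θ') p.2) ?_
      contDiff_fst (by norm_num)
    exact h.comp (contDiff_snd.prodMk (contDiff_snd.comp contDiff_fst))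
  exact this.continuous

/-- A continuous function on a product of closed balls has bounded norm. -/
theorem bddAbove_norm_closedBalls {F : Type*} [NormedAddCommGroup F] {g : Euc d → Euc q → F}
    (hg : Continuous (fun p : Euc d × Euc q => g p.1 p.2)) (BX Bθ : ℝ) :
    BddAbove {s | ∃ (x : Euc d) (θ : Euc q), ‖x‖ ≤ BX ∧ ‖θ‖ ≤ Bθ ∧ s = ‖g x θ‖} := by
  have hK : IsCompact (closedBall (0 : Euc d) BX ×ˢ closedBall (0 : Euc q) Bθ) :=
    (isCompact_closedBall _ _).prod (isCompact_closedBall _ _)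
  refine (hK.bddAbove_image hg.norm.continuousOn).mono ?_
  rintro _ ⟨x, θ, hx, hθ, rfl⟩
  exact ⟨(x, θ), by simp [hx, hθ], rfl⟩

theorem norm_le_supPolicy {pol : Euc d → Euc q → Euc m}
    (hpol : Continuous (fun p : Euc d × Euc q => pol p.1 p.2)) {BX Bθ : ℝ} {x : Euc d} {θ : Euc q}
    (hx : ‖x‖ ≤ BX) (hθ : ‖θ‖ ≤ Bθ) : ‖pol x θ‖ ≤ supPolicy pol BX Bθ :=
  le_csSup (bddAbove_norm_closedBalls hpol BX Bθ) ⟨x, θ, hx, hθ, rfl⟩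

theorem supPolicy_nonneg (pol : Euc d → Euc q → Euc m) (BX Bθ : ℝ) : 0 ≤ supPolicy pol BX Bθ :=
  Real.sSup_nonneg (by rintro _ ⟨x, θ, -, -, rfl⟩; positivity)

theorem supMixedDeriv_nonneg (pol : Euc d → Euc q → Euc m) (BX Bθ : ℝ) :
    0 ≤ supMixedDeriv pol BX Bθ :=
  Real.sSup_nonneg (by rintro _ ⟨x, θ, -, -, rfl⟩; positivity)

theorem norm_mixedDeriv_le {pol : Euc d → Euc q → Euc m}
    (hpol : ContDiff ℝ 2 (fun p : Euc d × Euc q => pol p.1 p.2)) {BX Bθ : ℝ} {x : Euc d}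
    {θ : Euc q} (hx : ‖x‖ ≤ BX) (hθ : ‖θ‖ ≤ Bθ) :
    ‖fderiv ℝ (fun x' : Euc d => fderiv ℝ (fun θ' : Euc q => pol x' θ') θ) x‖ ≤
      supMixedDeriv pol BX Bθ :=
  le_csSup (bddAbove_norm_closedBalls
    (g := fun x θ => fderiv ℝ (fun x' : Euc d => fderiv ℝ (fun θ' : Euc q => pol x' θ') θ) x)
    (continuous_mixedDeriv hpol) BX Bθ) ⟨x, θ, hx, hθ, rfl⟩

/-- On the open parameter ball the parameter derivative is at most `L_{ℓ,0}`. -/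
theorem norm_fderiv_param_le {pol : Euc d → Euc q → Euc m}
    (hpol : ContDiff ℝ 2 (fun p : Euc d × Euc q => pol p.1 p.2)) {BX Bθ : ℝ}
    (hzero : ∀ θ, ‖θ‖ ≤ Bθ → pol 0 θ = 0) {x : Euc d} {θ : Euc q}
    (hx : ‖x‖ ≤ BX) (hθ : ‖θ‖ < Bθ) :
    ‖fderiv ℝ (fun θ' => pol x θ') θ‖ ≤ lossLip pol BX Bθ := by
  have hBX : 0 ≤ BX := (norm_nonneg x).trans hx
  -- Policies vanish at the origin for all parameters near `θ`, which needs `θ` interior; the mean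
  -- value inequality in `x` then starts from a zero derivative.
  have h0 : fderiv ℝ (fun θ' => pol 0 θ') θ = 0 := by
    have heq : (fun θ' => pol 0 θ') =ᶠ[nhds θ] fun _ => 0 := by
      filter_upwards [isOpen_ball.mem_nhds (show θ ∈ ball (0 : Euc q) Bθ by simpa using hθ)]
        with θ' hθ'
      exact hzero θ' (by simpa using (mem_ball_zero_iff.1 hθ').le)
    rw [heq.fderiv_eq]
    simp
  have hdiff : ∀ y : Euc d, DifferentiableAt ℝ
      (fun x' : Euc d => fderiv ℝ (fun θ' : Euc q => pol x' θ') θ) y := fun y =>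
    (((contDiff_fderiv_param hpol).comp (contDiff_id.prodMk contDiff_const)).differentiable
      (by norm_num)) y
  have hmvt := (convex_closedBall (0 : Euc d) BX).norm_image_sub_le_of_norm_fderiv_le
    (f := fun x' : Euc d => fderiv ℝ (fun θ' : Euc q => pol x' θ') θ)
    (C := supMixedDeriv pol BX Bθ) (fun y _ => hdiff y)
    (fun y hy => norm_mixedDeriv_le hpol (by simpa using hy) hθ.le)
    (show (0 : Euc d) ∈ closedBall 0 BX by simpa using hBX)
    (show x ∈ closedBall 0 BX by simpa using hx)
  simp only [h0, sub_zero] at hmvt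
  refine hmvt.trans ?_
  rw [lossLip, mul_comm]
  exact mul_le_mul_of_nonneg_right hx (supMixedDeriv_nonneg _ _ _)

/-- Policies depend on the parameter in a Lipschitz way, uniformly over states in the ball. -/
theorem norm_pol_sub_le {pol : Euc d → Euc q → Euc m}
    (hpol : ContDiff ℝ 2 (fun p : Euc d × Euc q => pol p.1 p.2)) {BX Bθ : ℝ} (hBθ : 0 < Bθ)
    (hzero : ∀ θ, ‖θ‖ ≤ Bθ → pol 0 θ = 0) {x : Euc d} {θ c : Euc q}
    (hx : ‖x‖ ≤ BX) (hθ : ‖θ‖ ≤ Bθ) (hc : ‖c‖ ≤ Bθ) :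
    ‖pol x θ - pol x c‖ ≤ lossLip pol BX Bθ * ‖θ - c‖ := by
  have hcont : Continuous fun θ' => pol x θ' :=
    hpol.continuous.comp (continuous_const.prodMk continuous_id)
  have hdiff : ∀ θ', DifferentiableAt ℝ (fun θ' => pol x θ') θ' := fun θ' =>
    ((hpol.comp (contDiff_const.prodMk contDiff_id)).differentiable (by norm_num)) θ'
  set L := lossLip pol BX Bθ
  have hlip : ∀ p ∈ ball (0 : Euc q) Bθ ×ˢ ball (0 : Euc q) Bθ,
      ‖pol x p.1 - pol x p.2‖ ≤ L * ‖p.1 - p.2‖ := fun p hp =>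
    (convex_ball (0 : Euc q) Bθ).norm_image_sub_le_of_norm_fderiv_le
      (f := fun θ' => pol x θ') (fun y _ => hdiff y)
      (fun y hy => norm_fderiv_param_le hpol hzero hx (mem_ball_zero_iff.1 hy)) hp.2 hp.1
  -- The derivative bound holds only on the open ball; boundary parameters are reached by
  -- continuity.
  have hmem : (θ, c) ∈ closure (ball (0 : Euc q) Bθ ×ˢ ball (0 : Euc q) Bθ) := by
    rw [closure_prod_eq, closure_ball _ hBθ.ne']
    exact ⟨mem_closedBall_zero_iff.2 hθ, mem_closedBall_zero_iff.2 hc⟩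
  have hleft : Continuous fun p : Euc q × Euc q => ‖pol x p.1 - pol x p.2‖ :=
    ((hcont.comp continuous_fst).sub (hcont.comp continuous_snd)).norm
  have hright : Continuous fun p : Euc q × Euc q => L * ‖p.1 - p.2‖ := by fun_prop
  clear_value L
  have h := le_on_closure (f := fun p : Euc q × Euc q => ‖pol x p.1 - pol x p.2‖)
    (g := fun p : Euc q × Euc q => L * ‖p.1 - p.2‖) hlip hleft.continuousOn hright.continuousOn hmem
  exact h

end ImitationLearning

/-! ### From small loss to small imitation gap -/

namespace ImitationLearning

variable {d m : ℕ}

/-- The input `πhat (x̂_t) - π (x̂_t)` turns the expert closed loop into that of `πhat`. -/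
theorem perturbedState_eq_state {f : Euc d → Euc m → Euc d} {π πhat : Euc d → Euc m}
    {ξ : Euc d} {Δ : ℕ → Euc m} {t : ℕ}
    (h : ∀ s < t, Δ s = πhat (state f πhat ξ s) - π (state f πhat ξ s)) :
    perturbedState f π ξ Δ t = state f πhat ξ t := by
  induction t with
  | zero => rfl
  | succ t ih =>
    have hs := ih fun s hs => h s (hs.trans (Nat.lt_succ_self t))
    have ht := h t (Nat.lt_succ_self t)
    simp only [state, perturbedState] at hs ht ⊢
    rw [hs, ht]
    simp

/-- If `γ z` exceeded `x`, the intermediate value theorem on `[0, z]` would produce a preimage `y`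
of `x`, and `z ≤ g x ≤ y` would contradict monotonicity. Thus `γ` need not be surjective: values `x`
above its range cause no trouble. -/
theorem gain_le {γ : ℝ → ℝ} (hγ : IsClassK γ) {g : ℝ → ℝ} {α : ℝ}
    (hinv : ∀ x, 0 ≤ x → x ≤ α → ∀ y, 0 ≤ y → γ y = x → g x ≤ y) {x z : ℝ}
    (hx : 0 ≤ x) (hxα : x ≤ α) (hz : 0 ≤ z) (hzg : z ≤ g x) : γ z ≤ x := by
  by_contra! hlt
  obtain ⟨y, hy, hyx⟩ := intermediate_value_Icc hz
    (hγ.continuousOn.mono Set.Icc_subset_Ici_self) ⟨hγ.map_zero.trans_le hx, hlt.le⟩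
  have hzy : z ≤ y := hzg.trans (hinv x hx hxα y hy.1 hyx)
  have : γ z ≤ γ y := hγ.strictMonoOn.monotoneOn hz hy.1 hzy
  linarith

theorem le_loss (f : Euc d → Euc m → Euc d) (πstar πhat : Euc d → Euc m) {T t : ℕ} (ξ : Euc d)
    (ht : t < T) :
    ‖πhat (state f πstar ξ t) - πstar (state f πstar ξ t)‖ ≤ loss f πstar T ξ πhat :=
  le_ciSup (f := fun t : Fin T => ‖πhat (state f πstar ξ t) - πstar (state f πstar ξ t)‖)
    (Set.finite_range _).bddAbove ⟨t, ht⟩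

theorem loss_nonneg (f : Euc d → Euc m → Euc d) (πstar πhat : Euc d → Euc m) (T : ℕ) (ξ : Euc d) :
    0 ≤ loss f πstar T ξ πhat :=
  Real.iSup_nonneg fun _ => norm_nonneg _

theorem loss_le {f : Euc d → Euc m → Euc d} {πstar πhat : Euc d → Euc m} {T : ℕ} {ξ : Euc d}
    {a : ℝ} (ha : 0 ≤ a)
    (h : ∀ t < T, ‖πhat (state f πstar ξ t) - πstar (state f πstar ξ t)‖ ≤ a) :
    loss f πstar T ξ πhat ≤ a :=
  Real.iSup_le (fun t => h t t.2) ha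

theorem IsClassKL.map_zero_left {β : ℝ → ℝ → ℝ} (hβ : IsClassKL β) (t : ℕ) : β 0 t = 0 :=
  (hβ.classK t t.cast_nonneg).map_zero

/-- A policy with small loss along the expert trajectory stays close to the expert. -/
theorem imitationGap_le {f : Euc d → Euc m → Euc d} {πstar πhat : Euc d → Euc m}
    {X : Set (Euc d)} {η : ℝ} {β : ℝ → ℝ → ℝ} {γ : ℝ → ℝ}
    (hISS : IsLocallyDeltaISS f πstar X η β γ) {Lπ : ℝ} (hLπ : 0 ≤ Lπ)
    (hstar : ∀ x y, ‖πstar x - πstar y‖ ≤ Lπ * ‖x - y‖)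
    (hhat : ∀ x y, ‖πhat x - πhat y‖ ≤ Lπ * ‖x - y‖) {μ α p : ℝ} (hμ : 0 < μ) (hp : 0 < p)
    (hinv : ∀ x, 0 ≤ x → x ≤ α → ∀ y, 0 ≤ y → γ y = x → 2 * Lπ * x + (x / μ) ^ (1 / p) ≤ y)
    {T : ℕ} {ξ : Euc d} (hξ : ξ ∈ X)
    (hα : μ * loss f πstar T ξ πhat ^ p ≤ α)
    (hη : 2 * Lπ * (μ * loss f πstar T ξ πhat ^ p) + loss f πstar T ξ πhat ≤ η) :
    imitationGap f πstar T ξ πhat ≤ μ * loss f πstar T ξ πhat ^ p := by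
  set ε := loss f πstar T ξ πhat with hε
  have hε0 : 0 ≤ ε := loss_nonneg _ _ _ _ _
  set x := μ * ε ^ p with hx
  have hx0 : 0 ≤ x := by positivity
  have hroot : (x / μ) ^ (1 / p) = ε := by
    rw [hx, mul_div_cancel_left₀ _ hμ.ne', ← Real.rpow_mul hε0, mul_one_div_cancel hp.ne',
      Real.rpow_one]
  have key : ∀ t ≤ T, ‖state f πhat ξ t - state f πstar ξ t‖ ≤ x := by
    intro t
    induction t using Nat.strong_induction_on with
    | _ t ih =>
      intro htT
      -- Cut off at `t`: δ-ISS wants the bound `η` at all times, while the induction controls only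
      -- the past.
      let Δ : ℕ → Euc m := fun s =>
        if s < t then πhat (state f πhat ξ s) - πstar (state f πhat ξ s) else 0
      have hΔt : ∀ s < t, ‖Δ s‖ ≤ 2 * Lπ * x + ε := by
        intro s hs
        have h1 := hhat (state f πhat ξ s) (state f πstar ξ s)
        have h2 := hstar (state f πstar ξ s) (state f πhat ξ s)
        have h3 := le_loss f πstar πhat ξ (hs.trans_le htT)
        rw [norm_sub_rev (state f πstar ξ s)] at h2
        have h4 := mul_le_mul_of_nonneg_left (ih s hs (hs.le.trans htT)) hLπ
        have hsplit : Δ s = (πhat (state f πhat ξ s) - πhat (state f πstar ξ s)) +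
            (πhat (state f πstar ξ s) - πstar (state f πstar ξ s)) +
            (πstar (state f πstar ξ s) - πstar (state f πhat ξ s)) := by
          simp [Δ, hs]
        rw [hsplit]
        refine (norm_add₃_le).trans ?_
        linarith
      have hΔη : ∀ s, ‖Δ s‖ ≤ η := by
        intro s
        by_cases hs : s < t
        · exact (hΔt s hs).trans hη
        · have : 0 ≤ η := le_trans (by positivity) hη
          simpa [Δ, hs] using this
      -- Equal initial conditions make the `β` term vanish.
      have hbound := hISS.bound ξ hξ ξ hξ Δ hΔη t
      rw [perturbedState_eq_state (πhat := πhat) (fun s hs => by simp [Δ, hs]), sub_self,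
        norm_zero, hISS.classKL.map_zero_left, zero_add] at hbound
      refine hbound.trans (gain_le hISS.classK hinv hx0 hα
        (Real.iSup_nonneg fun _ => norm_nonneg _) ?_)
      rw [hroot]
      exact Real.iSup_le (fun k => hΔt k k.2) (by positivity)
  exact Real.iSup_le (fun t => key (t + 1) t.2) hx0

/-- The expert trajectory depends continuously on the initial condition. -/
theorem IsLocallyDeltaISS.continuousOn_state {f : Euc d → Euc m → Euc d} {π : Euc d → Euc m}
    {X : Set (Euc d)} {η : ℝ} {β : ℝ → ℝ → ℝ} {γ : ℝ → ℝ}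
    (hISS : IsLocallyDeltaISS f π X η β γ) (hη : 0 ≤ η) (t : ℕ) :
    ContinuousOn (fun ξ => state f π ξ t) X := by
  intro ξ hξ
  have hγ : (⨆ k : Fin t, ‖(fun _ => 0 : ℕ → Euc m) k‖) = 0 := by simp
  have hβ : Filter.Tendsto (fun y => β ‖y - ξ‖ t) (nhdsWithin ξ X) (nhds 0) := by
    have hcont := (hISS.classKL.classK t t.cast_nonneg).continuousOn 0 Set.self_mem_Ici
    rw [ContinuousWithinAt, hISS.classKL.map_zero_left] at hcont
    refine hcont.comp (tendsto_nhdsWithin_iff.2 ⟨?_, Filter.Eventually.of_forall fun y => norm_nonneg _⟩)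
    have : Continuous fun y => ‖y - ξ‖ := by fun_prop
    simpa using (this.tendsto ξ).mono_left (nhdsWithin_le_nhds (s := X))
  rw [ContinuousWithinAt, tendsto_iff_norm_sub_tendsto_zero]
  refine squeeze_zero' (Filter.Eventually.of_forall fun _ => norm_nonneg _) ?_ hβ
  filter_upwards [self_mem_nhdsWithin] with y hy
  have h := hISS.bound y hy ξ hξ (fun _ => 0) (by simpa using fun _ : ℕ => hη) t
  rw [hγ, hISS.classK.map_zero, add_zero] at h
  exact h

end ImitationLearning

/-! ### Elementary inequalities, the union bound and measurability -/

namespace ImitationLearning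

open MeasureTheory

/-- An inequality `n ≳ a log b` with `b = K a` self-bounds to `n ≳ a log (K n)`. -/
theorem log_mul_le_of_burnIn {a K n : ℝ} (ha : 0 < a) (hK : 1 ≤ K) (hn : 1000 ≤ n)
    (hlog : 1000 * (a * Real.log (K * a)) ≤ n) : 4 * (a * Real.log (K * n)) ≤ n := by
  have hn0 : 0 < n := by linarith
  have hKa : a ≤ K * a := le_mul_of_one_le_left ha.le hK
  obtain ⟨u, rfl⟩ : ∃ u, n = a * u := ⟨n / a, by field_simp⟩
  have hu0 : 0 < u := pos_of_mul_pos_right hn0 ha.le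
  have hu1 : 1000 * Real.log (K * a) ≤ u := le_of_mul_le_mul_left (by linarith) ha
  -- If `a ≤ 3`, this follows from `n ≥ 1000`; otherwise `log (K a) ≥ 1`. Then `√u ≥ 16` gives `log
  -- u ≤ u / 8`.
  have hu : 256 ≤ u := by
    rcases le_total a 3 with h3 | h3
    · nlinarith
    · have h1 : Real.log (Real.exp 1) ≤ Real.log (K * a) :=
        Real.log_le_log (Real.exp_pos 1) (by linarith [Real.exp_one_lt_three])
      rw [Real.log_exp] at h1
      linarith
  have hsq : 16 ≤ √u := Real.le_sqrt_of_sq_le (by norm_num; exact hu)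
  have hlogu : Real.log u ≤ u / 8 := by
    have h1 := Real.log_sqrt hu0.le
    have h2 := Real.log_le_sub_one_of_pos (show 0 < √u by linarith)
    have h3 := Real.mul_self_sqrt hu0.le
    nlinarith
  rw [← mul_assoc K, Real.log_mul (by positivity) (by positivity)]
  nlinarith

/-- With `L = log (K n)`, `exp x = K n exp (x - L)` and `exp (x - L) ≥ 1 + x - L ≥ x / L`; a factor
`n ≥ 5` covers `4` and the summand `1`. The left side is the net-size bound per dimension. -/
theorem one_add_le_exp_of_log_le {K n x : ℝ} (hK : 1 ≤ K) (hn : 5 ≤ n)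
    (hx : Real.log (K * n) ≤ x) : 1 + 4 * K * x / Real.log (K * n) ≤ Real.exp x := by
  have hKn : 5 ≤ K * n := by nlinarith
  set L := Real.log (K * n)
  have hL : 1 ≤ L := by
    rw [Real.le_log_iff_exp_le (by linarith)]
    linarith [Real.exp_one_lt_three]
  have hL0 : 0 < L := by linarith
  have hy : 1 ≤ x / L := (one_le_div hL0).2 hx
  have hexp : Real.exp x = K * n * Real.exp (x - L) := by
    rw [Real.exp_sub, Real.exp_log (by linarith)]
    field_simp
  have h1 : x / L ≤ Real.exp (x - L) := by
    refine le_trans ?_ (Real.add_one_le_exp _)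
    rw [div_le_iff₀ hL0]
    nlinarith
  calc 1 + 4 * K * x / L = 1 + 4 * K * (x / L) := by ring
    _ ≤ K * n * (x / L) := by nlinarith [mul_nonneg (sub_nonneg.2 hK) (sub_nonneg.2 hy)]
    _ ≤ Real.exp x := by rw [hexp]; gcongr

/-- The shift `1 / n` matches the `1` in `y + 1 ≤ exp y` at `y = n (p - δ)`; then `(1 - p) ^ n ≤ exp
(-n p)` cancels `p`. -/
theorem mul_one_sub_pow_le {p δ : ℝ} {n : ℕ} (hn : 0 < n) (hp1 : p ≤ 1) :
    max (p - (δ - 1 / n)) 0 * (1 - p) ^ n ≤ Real.exp (-(n * δ)) / n := by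
  have hn' : (0 : ℝ) < n := by exact_mod_cast hn
  have h1 : max (p - (δ - 1 / n)) 0 ≤ Real.exp (n * (p - δ)) / n := by
    refine max_le ?_ (by positivity)
    rw [le_div_iff₀ hn']
    refine le_trans (le_of_eq ?_) (Real.add_one_le_exp _)
    field_simp
    ring
  have h2 : (1 - p) ^ n ≤ Real.exp (-(n * p)) := by
    calc (1 - p) ^ n ≤ Real.exp (-p) ^ n :=
          pow_le_pow_left₀ (by linarith) (Real.one_sub_le_exp_neg p) n
      _ = Real.exp (-(n * p)) := by rw [← Real.exp_nat_mul]; ring_nf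
  calc _ ≤ Real.exp (n * (p - δ)) / n * Real.exp (-(n * p)) := by
        apply mul_le_mul h1 h2 (pow_nonneg (by linarith) _) (by positivity)
    _ = Real.exp (-(n * δ)) / n := by
        rw [div_mul_eq_mul_div, ← Real.exp_add]; ring_nf

/-- If a finite family of events, at most `exp (n δ)` many, contains for almost every sample one
that avoids the sample and covers the failure event on the fresh draw, then failure has
probability at most `δ`. -/
theorem measure_prod_le_of_avoiding {Ω ι : Type*} [MeasurableSpace Ω] (D : Measure Ω)
    [IsProbabilityMeasure D] {n : ℕ} (hn : 0 < n) (s : Finset ι) {A : ι → Set Ω}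
    (hA : ∀ i, MeasurableSet (A i)) {E : Set ((Fin n → Ω) × Ω)} (hE : MeasurableSet E)
    (h : ∀ᵐ S ∂(Measure.pi fun _ : Fin n => D),
      ∃ i ∈ s, Prod.mk S ⁻¹' E ⊆ A i ∧ ∀ k, S k ∉ A i)
    {δ : ℝ} (hδ : 1 / n ≤ δ) (hcard : (s.card : ℝ) ≤ Real.exp (n * δ)) :
    ((Measure.pi fun _ : Fin n => D).prod D) E ≤ ENNReal.ofReal δ := by
  classical
  have hn' : (0 : ℝ) < n := by exact_mod_cast hn
  set δ' : ENNReal := ENNReal.ofReal (δ - 1 / n)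
  let C : ι → Set (Fin n → Ω) := fun i => Set.univ.pi fun _ => (A i)ᶜ
  have hC : ∀ i, MeasurableSet (C i) := fun i => MeasurableSet.univ_pi fun _ => (hA i).compl
  have hterm : ∀ i, (D (A i) - δ') * (Measure.pi fun _ : Fin n => D) (C i) ≤
      ENNReal.ofReal (Real.exp (-(n * δ)) / n) := by
    intro i
    have hp : D (A i) = ENNReal.ofReal (D.real (A i)) := by simp
    have hc : D (A i)ᶜ = ENNReal.ofReal (1 - D.real (A i)) := by
      rw [← probReal_compl_eq_one_sub (hA i)]; simp
    have hp1 : D.real (A i) ≤ 1 := measureReal_le_one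
    rw [Measure.pi_pi, Finset.prod_const, Finset.card_univ, Fintype.card_fin, hc, hp,
      ← ENNReal.ofReal_sub _ (by linarith), ← ENNReal.ofReal_pow (by linarith),
      ← ENNReal.ofReal_mul' (pow_nonneg (by linarith) _)]
    refine ENNReal.ofReal_le_ofReal (le_trans ?_ (mul_one_sub_pow_le hn hp1))
    exact mul_le_mul_of_nonneg_right (le_max_left _ _) (pow_nonneg (by linarith) _)
  calc ((Measure.pi fun _ : Fin n => D).prod D) E
      = ∫⁻ S, D (Prod.mk S ⁻¹' E) ∂(Measure.pi fun _ : Fin n => D) := Measure.prod_apply hE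
    -- For a given sample, the failure probability is at most `δ'` plus the excess of `D (A i)` over
    -- `δ'` for one avoided `A i`. Truncated subtraction keeps all terms nonnegative, so summing
    -- over `s` is harmless; the sum integrates to at most `1 / n`.
    _ ≤ ∫⁻ S, (δ' + ∑ i ∈ s, (C i).indicator (fun _ => D (A i) - δ') S)
          ∂(Measure.pi fun _ : Fin n => D) := by
        refine lintegral_mono_ae ?_
        filter_upwards [h] with S ⟨i, hi, hsub, havoid⟩
        have hmem : S ∈ C i := fun k _ => havoid k
        calc D (Prod.mk S ⁻¹' E) ≤ D (A i) := measure_mono hsub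
          _ ≤ δ' + (D (A i) - δ') := le_add_tsub
          _ = δ' + (C i).indicator (fun _ => D (A i) - δ') S := by
              rw [Set.indicator_of_mem hmem]
          _ ≤ _ := by
              gcongr
              exact Finset.single_le_sum
                (f := fun i => (C i).indicator (fun _ => D (A i) - δ') S) (fun _ _ => zero_le) hi
    _ = δ' + ∑ i ∈ s, (D (A i) - δ') * (Measure.pi fun _ : Fin n => D) (C i) := by
        rw [lintegral_add_left measurable_const, lintegral_finsetSum _
          fun i _ => measurable_const.indicator (hC i)]
        simp [hC]
    _ ≤ δ' + ∑ i ∈ s, ENNReal.ofReal (Real.exp (-(n * δ)) / n) := by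
        gcongr with i
        exact hterm i
    _ = ENNReal.ofReal (δ - 1 / n + s.card * (Real.exp (-(n * δ)) / n)) := by
        rw [Finset.sum_const, nsmul_eq_mul, ENNReal.ofReal_add (by linarith) (by positivity),
          ENNReal.ofReal_mul (by positivity), ENNReal.ofReal_natCast]
    _ ≤ ENNReal.ofReal δ := by
        refine ENNReal.ofReal_le_ofReal ?_
        have : (s.card : ℝ) * Real.exp (-(n * δ)) ≤ 1 := by
          rw [Real.exp_neg, ← div_eq_mul_inv]
          exact (div_le_one (Real.exp_pos _)).2 hcard
        rw [← mul_div_assoc]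
        have := div_le_div_of_nonneg_right this hn'.le
        linarith

/-- No regularity of `f` is assumed, so the state is known to be regular only on `X`; it is replaced
by `0` elsewhere. -/
theorem measurableSet_lt_loss {d m : ℕ} {Ω : Type*} [MeasurableSpace Ω]
    {f : Euc d → Euc m → Euc d} {πstar : Euc d → Euc m} (hstar : Measurable πstar)
    {X : Set (Euc d)} (hX : MeasurableSet X)
    (hstate : ∀ t, ContinuousOn (fun ξ => state f πstar ξ t) X)
    {P : Ω → Euc d → Euc m} (hP : Measurable fun p : Ω × Euc d => P p.1 p.2) (T : ℕ) (τ : ℝ) :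
    MeasurableSet {ω : Ω × Euc d | ω.2 ∈ X ∧ τ < loss f πstar T ω.2 (P ω.1)} := by
  classical
  let g : ℕ → Euc d → Euc d := fun t => X.piecewise (fun ξ => state f πstar ξ t) fun _ => 0
  have hg : ∀ t, Measurable (g t) := fun t =>
    (hstate t).measurable_piecewise continuousOn_const hX
  have hmeas : Measurable fun ω : Ω × Euc d =>
      ⨆ t : Fin T, ‖P ω.1 (g t ω.2) - πstar (g t ω.2)‖ := by
    refine Measurable.iSup fun t => Measurable.norm (Measurable.sub ?_ ?_)
    · exact hP.comp (measurable_fst.prodMk ((hg t).comp measurable_snd))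
    · exact hstar.comp ((hg t).comp measurable_snd)
  have heq : {ω : Ω × Euc d | ω.2 ∈ X ∧ τ < loss f πstar T ω.2 (P ω.1)} =
      Prod.snd ⁻¹' X ∩ {ω | τ < ⨆ t : Fin T, ‖P ω.1 (g t ω.2) - πstar (g t ω.2)‖} := by
    ext ω
    simp only [Set.mem_ofPred_eq, Set.mem_inter_iff, Set.mem_preimage]
    refine and_congr_right fun hω => ?_
    simp [loss, g, hω]
  rw [heq]
  exact (measurable_snd hX).inter (measurableSet_lt measurable_const hmeas)

end ImitationLearning

/-! ### Generalization of the empirical risk minimizer -/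

namespace ImitationLearning

open MeasureTheory

variable {d m q : ℕ}

/-- Excludes `q = 0` in the main theorem, where `1 ≤ Bθ * Bl⁻¹ * Ll` would fail. -/
theorem lossLip_eq_zero_of_dim_eq_zero (pol : Euc d → Euc 0 → Euc m) (BX Bθ : ℝ) :
    lossLip pol BX Bθ = 0 := by
  have h : supMixedDeriv pol BX Bθ ≤ 0 := by
    refine Real.sSup_le ?_ le_rfl
    rintro _ ⟨x, θ, -, -, rfl⟩
    have hz : fderiv ℝ (fun x' : Euc d => fderiv ℝ (fun θ' : Euc 0 => pol x' θ') θ) x = 0 := by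
      ext v w
      rw [Subsingleton.elim w 0]
      simp
    exact (congrArg norm hz).le.trans (norm_zero (E := Euc d →L[ℝ] Euc 0 →L[ℝ] Euc m)).le
  rw [lossLip, le_antisymm h (supMixedDeriv_nonneg _ _ _), mul_zero]

/-- On realizable data an empirical risk minimizer has zero loss on every sample point. -/
theorem IsERM.loss_eq_zero {f : Euc d → Euc m → Euc d} {πstar πhat : Euc d → Euc m} {T n : ℕ}
    {Pi : Set (Euc d → Euc m)} {S : Fin n → Euc d} (h : IsERM f πstar T Pi S πhat)
    (hstar : πstar ∈ Pi) (k : Fin n) : loss f πstar T (S k) πhat = 0 := by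
  have hn : (0 : ℝ) < 1 / n := by
    have : 0 < n := k.pos
    positivity
  have h1 := h.2 πstar hstar
  have h2 : ∀ i, loss f πstar T (S i) πstar = 0 := fun i => by simp [loss]
  simp only [h2, Finset.sum_const_zero, mul_zero] at h1
  have h3 : ∑ i, loss f πstar T (S i) πhat ≤ 0 := nonpos_of_mul_nonpos_right h1 hn
  have h4 := Finset.single_le_sum (f := fun i => loss f πstar T (S i) πhat)
    (fun i _ => loss_nonneg f πstar πhat T (S i)) (Finset.mem_univ k)
  exact le_antisymm (h4.trans h3) (loss_nonneg _ _ _ _ _)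

/-- With probability at least `1 - δ` an empirical risk minimizer over a realizable parametric
class has loss at most `B q log (K n) / (n δ)` on a fresh initial condition. -/
theorem measure_lt_loss_erm_le {f : Euc d → Euc m → Euc d} {X : Set (Euc d)}
    (hX : MeasurableSet X) (D : Measure (Euc d)) [IsProbabilityMeasure D] (hDX : ∀ᵐ ξ ∂D, ξ ∈ X)
    {pol : Euc d → Euc q → Euc m} (hpol : Continuous fun p : Euc d × Euc q => pol p.1 p.2)
    {Bθ B Lip : ℝ} (hBθ : 0 < Bθ) (hB : 0 < B) (hLip : 0 < Lip) {πstar : Euc d → Euc m}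
    (hstar : πstar ∈ policyClass pol Bθ) {T n : ℕ}
    (hstate : ∀ t, ContinuousOn (fun ξ => state f πstar ξ t) X)
    (hbound : ∀ ξ ∈ X, ∀ t, ∀ θ, ‖θ‖ ≤ Bθ →
      ‖pol (state f πstar ξ t) θ - πstar (state f πstar ξ t)‖ ≤ B)
    (hlip : ∀ ξ ∈ X, ∀ t, ∀ θ, ‖θ‖ ≤ Bθ → ∀ c, ‖c‖ ≤ Bθ →
      ‖pol (state f πstar ξ t) θ - pol (state f πstar ξ t) c‖ ≤ Lip * ‖θ - c‖)
    (hK : 1 ≤ Bθ * B⁻¹ * Lip) (hq : 0 < q) (hn : 5 ≤ n)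
    {πhat : (Fin n → Euc d) → Euc d → Euc m}
    (hmeas : Measurable fun p : (Fin n → Euc d) × Euc d => πhat p.1 p.2)
    (herm : ∀ᵐ S ∂(Measure.pi fun _ : Fin n => D),
      IsERM f πstar T (policyClass pol Bθ) S (πhat S)) {δ : ℝ} (hδ : 0 < δ) :
    ((Measure.pi fun _ : Fin n => D).prod D)
      {ω | ω.2 ∈ X ∧ 1 / δ * (B * q * Real.log (Bθ * B⁻¹ * Lip * n) / n) <
        loss f πstar T ω.2 (πhat ω.1)} ≤ ENNReal.ofReal δ := by
  set K := Bθ * B⁻¹ * Lip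
  set L := Real.log (K * n)
  set τ := 1 / δ * (B * q * L / n) with hτ
  have hn5 : (5 : ℝ) ≤ n := by exact_mod_cast hn
  have hn0 : (0 : ℝ) < n := by linarith
  have hq1 : (1 : ℝ) ≤ q := by exact_mod_cast hq
  have hq0 : (0 : ℝ) < q := by linarith
  have hL1 : 1 ≤ L := by
    rw [Real.le_log_iff_exp_le (by positivity)]
    nlinarith [Real.exp_one_lt_three]
  have hL0 : 0 < L := by linarith
  have hτ0 : 0 < τ := by positivity
  have hloss : ∀ ξ ∈ X, ∀ θ, ‖θ‖ ≤ Bθ → loss f πstar T ξ (fun x => pol x θ) ≤ B :=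
    fun ξ hξ θ hθ => loss_le hB.le fun t _ => hbound ξ hξ t θ hθ
  -- If `B ≤ τ`, the loss almost surely cannot exceed `τ`. Otherwise `L ≤ n δ / q`, as the net-size
  -- estimate requires.
  rcases le_or_gt B τ with hBτ | hτB
  · refine le_of_eq_of_le ?_ (zero_le)
    refine measure_eq_zero_iff_ae_notMem.2 ?_
    filter_upwards [Measure.quasiMeasurePreserving_fst.ae herm] with ω hω hfail
    obtain ⟨⟨θ, hθ, hπ⟩, -⟩ := hω
    have := hloss ω.2 hfail.1 θ hθ
    rw [← hπ] at this
    exact absurd hfail.2 (not_lt.2 (this.trans hBτ))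
  set x := n * δ / q with hx
  have hτx : τ = B * L / x := by rw [hτ, hx]; field_simp
  have hx0 : 0 < x := by positivity
  have hLx : L ≤ x := by
    rw [hτx, div_lt_iff₀ hx0] at hτB
    exact (lt_of_mul_lt_mul_left hτB hB.le).le
  -- At this net scale, policy values along expert trajectories move by at most `τ / 2`.
  have hs : 0 < τ / (2 * Lip) := by positivity
  obtain ⟨net, hcard, hnet, hcover⟩ := exists_net_closedBall (Euc q) hBθ.le hs
  have hstarm : Measurable πstar := by
    obtain ⟨θ, -, rfl⟩ := hstar
    exact (hpol.comp (continuous_id.prodMk continuous_const)).measurable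
  refine measure_prod_le_of_avoiding D (by omega) net
    (A := fun c => {ξ | ξ ∈ X ∧ τ / 2 < loss f πstar T ξ fun x => pol x c}) ?_
    (measurableSet_lt_loss hstarm hX hstate hmeas T τ) ?_ ?_ ?_
  · intro c
    have hc : Measurable fun p : Unit × Euc d => pol p.2 c :=
      (hpol.comp (continuous_snd.prodMk continuous_const)).measurable
    exact measurable_prodMk_left (x := ())
      (measurableSet_lt_loss (P := fun _ x => pol x c) hstarm hX hstate hc T (τ / 2))
  · have hSX : ∀ᵐ S ∂(Measure.pi fun _ : Fin n => D), ∀ k, S k ∈ X :=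
      ae_all_iff.2 fun k => (Measure.quasiMeasurePreserving_eval (fun _ : Fin n => D) k).ae hDX
    filter_upwards [herm, hSX] with S hS hSX
    obtain ⟨θ, hθ, hπ⟩ := hS.1
    obtain ⟨c, hc, hθc⟩ := hcover θ hθ
    have hclose : ∀ ξ ∈ X, ∀ t,
        ‖pol (state f πstar ξ t) θ - pol (state f πstar ξ t) c‖ ≤ τ / 2 := by
      intro ξ hξ t
      refine (hlip ξ hξ t θ hθ c (hnet c hc)).trans ?_
      calc Lip * ‖θ - c‖ ≤ Lip * (τ / (2 * Lip)) := by gcongr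
        _ = τ / 2 := by field_simp
    refine ⟨c, hc, ?_, ?_⟩
    · rintro ξ ⟨hξ, hlt⟩
      refine ⟨hξ, ?_⟩
      by_contra! hle
      refine absurd hlt (not_lt.2 (loss_le hτ0.le fun t ht => ?_))
      have h1 := le_loss f πstar (fun x => pol x c) ξ ht
      have h2 := hclose ξ hξ t
      have h3 := norm_sub_le_norm_sub_add_norm_sub (pol (state f πstar ξ t) θ)
        (pol (state f πstar ξ t) c) (πstar (state f πstar ξ t))
      simp only [hπ]
      linarith
    · rintro k ⟨-, hlt⟩
      refine absurd hlt (not_lt.2 (loss_le (by positivity) fun t ht => ?_))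
      have h1 := le_loss f πstar (πhat S) (S k) ht
      rw [hS.loss_eq_zero hstar k, hπ] at h1
      have h2 := hclose (S k) (hSX k) t
      rw [norm_sub_rev] at h2
      have h3 := norm_sub_le_norm_sub_add_norm_sub (pol (state f πstar (S k) t) c)
        (pol (state f πstar (S k) t) θ) (πstar (state f πstar (S k) t))
      linarith
  · rw [div_le_iff₀ hn0]
    have : 1 ≤ x := hL1.trans hLx
    rw [hx, one_le_div hq0] at this
    linarith
  · have hbase : 1 + 2 * Bθ / (τ / (2 * Lip)) ≤ Real.exp x := by
      refine le_of_eq_of_le ?_ (one_add_le_exp_of_log_le hK hn5 hLx)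
      rw [hτx]
      simp only [K, L]
      field_simp
      ring
    refine hcard.trans ((pow_le_pow_left₀ (by positivity) hbase _).trans_eq ?_)
    rw [← Real.exp_nat_mul, finrank_euclideanSpace, Fintype.card_fin, hx]
    congr 1
    field_simp

/-- The burn-in requirement keeps the statistical rate below `q / (4 κ)`. -/
theorem rate_mul_le_of_burnInTerm {B Lip Bθ δ κ n : ℝ} (hB : 0 < B) (hδ : 0 < δ) (hκ : 0 < κ)
    (hK : 1 ≤ Bθ * B⁻¹ * Lip) (hn : 1000 ≤ n) (h : 1000 * burnInTerm B Lip Bθ δ κ ≤ n) :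
    4 * (1 / δ * (B * κ * Real.log (Bθ * B⁻¹ * Lip * n) / n)) ≤ 1 := by
  have hn0 : 0 < n := by linarith
  -- Puts the burn-in in the form `a log (K a)` with `a = B κ / δ`.
  have harg : κ * Bθ * Lip / δ = Bθ * B⁻¹ * Lip * (B * (κ / δ)) := by field_simp
  rw [burnInTerm, harg] at h
  have hmain := log_mul_le_of_burnIn (a := B * (κ / δ)) (by positivity) hK hn h
  calc _ = 4 * (B * (κ / δ) * Real.log (Bθ * B⁻¹ * Lip * n)) / n := by field_simp
    _ ≤ 1 := (div_le_one hn0).2 hmain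

end ImitationLearning

/-! ### The main theorem -/

open ImitationLearning MeasureTheory in
theorem mainTheorem2 :
    ∃ C₁ : ℝ, 0 < C₁ ∧ ∃ C₂ : ℝ, 0 < C₂ ∧
      ∀ (d m q T n : ℕ)
        -- dynamics, initial conditions
        (f : ImitationLearning.Euc d → ImitationLearning.Euc m → ImitationLearning.Euc d)
        (X : Set (ImitationLearning.Euc d)) (_ : IsCompact X)
        (D : MeasureTheory.Measure (ImitationLearning.Euc d))
        (_ : MeasureTheory.IsProbabilityMeasure D) (_ : D Xᶜ = 0)
        -- parametric policy class
        (pol : ImitationLearning.Euc d → ImitationLearning.Euc q → ImitationLearning.Euc m)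
        (Bθ : ℝ)
        (_ : ContDiff ℝ 2
          (fun p : ImitationLearning.Euc d × ImitationLearning.Euc q => pol p.1 p.2))
        (_ : ∀ θ, ‖θ‖ ≤ Bθ → pol 0 θ = 0)
        -- realizable expert with bounded closed-loop trajectories
        (πstar : ImitationLearning.Euc d → ImitationLearning.Euc m)
        (_ : πstar ∈ ImitationLearning.policyClass pol Bθ)
        (BX : ℝ) (_ : 0 < BX)
        (_ : ∀ t : ℕ, ∀ ξ ∈ X, ‖ImitationLearning.state f πstar ξ t‖ ≤ BX)
        (Bl Ll : ℝ) (_ : Bl = ImitationLearning.lossBound pol BX Bθ)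
        (_ : Ll = ImitationLearning.lossLip pol BX Bθ)
        (_ : 1 ≤ Bθ * Bl⁻¹ * Ll)
        -- Lipschitz policies
        (Lπ : ℝ) (_ : 0 ≤ Lπ)
        (_ : ∀ π ∈ ImitationLearning.policyClass pol Bθ, ∀ x y, ‖π x - π y‖ ≤ Lπ * ‖x - y‖)
        -- stability of the expert
        (η : ℝ) (_ : 0 < η) (β : ℝ → ℝ → ℝ) (γ : ℝ → ℝ)
        (_ : ImitationLearning.IsLocallyDeltaISS f πstar X η β γ)
        (r : ℝ) (_ : 0 < r)
        (_ : γ =O[nhdsWithin 0 (Set.Ioi 0)] fun x : ℝ => x ^ (1 + r))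
        -- `2 Lπ x + (x / μ) ^ (1 / (1 + r)) ≤ γ⁻¹(x)` on `[0, α]`; here `y` is `γ⁻¹(x)`, and
        -- `γ⁻¹(x)` counts as `∞` for `x` above the range of `γ`
        (μ α : ℝ) (_ : 0 < μ) (_ : 0 < α)
        (_ : ∀ x, 0 ≤ x → x ≤ α → ∀ y, 0 ≤ y → γ y = x →
          2 * Lπ * x + (x / μ) ^ (1 / (1 + r)) ≤ y)
        (_ : α / μ ≤ 1) (_ : 1 / 2 ≤ Lπ * μ)
        -- empirical risk minimizer
        (πhat : (Fin n → ImitationLearning.Euc d) →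
          ImitationLearning.Euc d → ImitationLearning.Euc m)
        (_ : Measurable
          (fun p : (Fin n → ImitationLearning.Euc d) × ImitationLearning.Euc d => πhat p.1 p.2))
        (_ : ∀ᵐ S ∂(MeasureTheory.Measure.pi fun _ : Fin n => D),
          ImitationLearning.IsERM f πstar T (ImitationLearning.policyClass pol Bθ) S (πhat S))
        -- failure probability and burn-in
        (δ : ℝ) (_ : 0 < δ) (_ : δ < 1)
        (_ : C₁ * max 1 (max
            (ImitationLearning.burnInTerm Bl Ll Bθ δ ((q : ℝ) * (μ / α) ^ (1 / (1 + r))))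
            (ImitationLearning.burnInTerm Bl Ll Bθ δ ((q : ℝ) * Lπ * μ / η))) ≤ (n : ℝ)),
        -- the bound fails with probability at most `δ` over the sample and the fresh draw
        ((MeasureTheory.Measure.pi fun _ : Fin n => D).prod D)
            {ω : (Fin n → ImitationLearning.Euc d) × ImitationLearning.Euc d |
              ¬ ImitationLearning.imitationGap f πstar T ω.2 (πhat ω.1) ≤
                C₂ * μ * (1 / δ * (Bl * q * Real.log (Bθ * Bl⁻¹ * Ll * n) / n)) ^ (1 + r)}
          ≤ ENNReal.ofReal δ := by
  refine ⟨1000, by norm_num, 1, one_pos, ?_⟩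
  intro d m q T n f X hX D hD hDX pol Bθ hpol hzero πstar hstar BX hBX htraj Bl Ll hBl hLl hK
    Lπ hLπ hpolLip η hη β γ hISS r hr _ μ α hμ hα hinv hαμ hLπμ πhat hmeas herm δ hδ _ hburn
  have hBl0 : 0 < Bl := by
    have h1 : 0 ≤ Bl := by rw [hBl, lossBound]; linarith [supPolicy_nonneg pol BX Bθ]
    refine lt_of_le_of_ne h1 fun h => ?_
    rw [← h] at hK
    norm_num at hK
  have hLl0 : 0 ≤ Ll := by rw [hLl]; exact mul_nonneg hBX.le (supMixedDeriv_nonneg _ _ _)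
  have hLl1 : 0 < Ll := by
    refine lt_of_le_of_ne hLl0 fun h => ?_
    rw [← h] at hK
    norm_num at hK
  have hBθ : 0 < Bθ := by
    have h1 : 0 < Bθ * (Bl⁻¹ * Ll) := by rw [← mul_assoc]; linarith
    exact pos_of_mul_pos_left h1 (by positivity)
  have hq : 0 < q := by
    rcases Nat.eq_zero_or_pos q with rfl | h
    · rw [lossLip_eq_zero_of_dim_eq_zero] at hLl
      exact absurd hLl hLl1.ne'
    · exact h
  have hq0 : (0 : ℝ) < q := by exact_mod_cast hq
  have hLπ0 : 0 < Lπ := by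
    refine lt_of_le_of_ne hLπ fun h => ?_
    rw [← h] at hLπμ
    norm_num at hLπμ
  have hp : 0 < 1 + r := by linarith
  have hn : (1000 : ℝ) ≤ n := by linarith [le_max_left (1 : ℝ) (max
    (burnInTerm Bl Ll Bθ δ ((q : ℝ) * (μ / α) ^ (1 / (1 + r))))
    (burnInTerm Bl Ll Bθ δ ((q : ℝ) * Lπ * μ / η)))]
  have hn5 : 5 ≤ n := by
    have : 1000 ≤ n := by exact_mod_cast hn
    omega
  have hn0 : (0 : ℝ) < n := by linarith
  have hK0 : 1 ≤ Bθ * Bl⁻¹ * Ll * n := by nlinarith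
  have hrateα := rate_mul_le_of_burnInTerm (κ := (q : ℝ) * (μ / α) ^ (1 / (1 + r))) hBl0 hδ
    (by positivity) hK hn (le_trans (mul_le_mul_of_nonneg_left
      ((le_max_left _ _).trans (le_max_right _ _)) (by norm_num)) hburn)
  have hrateη := rate_mul_le_of_burnInTerm (κ := (q : ℝ) * Lπ * μ / η) hBl0 hδ
    (by positivity) hK hn (le_trans (mul_le_mul_of_nonneg_left
      ((le_max_right _ _).trans (le_max_right _ _)) (by norm_num)) hburn)
  have hXae : ∀ᵐ ξ ∂D, ξ ∈ X := hDX
  have hstate := hISS.continuousOn_state hη.le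
  have hsup : ∀ ξ ∈ X, ∀ t, ∀ θ, ‖θ‖ ≤ Bθ →
      ‖pol (state f πstar ξ t) θ‖ ≤ supPolicy pol BX Bθ := fun ξ hξ t θ hθ =>
    norm_le_supPolicy hpol.continuous (htraj t ξ hξ) hθ
  have hbound : ∀ ξ ∈ X, ∀ t, ∀ θ, ‖θ‖ ≤ Bθ →
      ‖pol (state f πstar ξ t) θ - πstar (state f πstar ξ t)‖ ≤ Bl := by
    intro ξ hξ t θ hθ
    obtain ⟨θ', hθ', hπ⟩ := id hstar
    have h1 := hsup ξ hξ t θ hθ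
    have h2 : ‖πstar (state f πstar ξ t)‖ ≤ supPolicy pol BX Bθ := by
      conv_lhs => rw [congrFun hπ (state f πstar ξ t)]
      exact hsup ξ hξ t θ' hθ'
    rw [hBl, lossBound]
    linarith [norm_sub_le (pol (state f πstar ξ t) θ) (πstar (state f πstar ξ t))]
  have hprob := measure_lt_loss_erm_le hX.isClosed.measurableSet D hXae hpol.continuous hBθ hBl0
    hLl1 hstar hstate hbound
    (fun ξ hξ t θ hθ c hc => hLl ▸ norm_pol_sub_le hpol hBθ hzero (htraj t ξ hξ) hθ hc)
    hK hq hn5 hmeas herm hδ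
  -- The gap event need not be measurable; it is contained almost everywhere in the measurable event
  -- of large loss.
  refine (measure_mono_ae ?_).trans hprob
  filter_upwards [Measure.quasiMeasurePreserving_fst.ae herm,
    Measure.quasiMeasurePreserving_snd.ae hXae] with ω hω hωX hfail
  refine ⟨hωX, ?_⟩
  by_contra! hle
  refine hfail ?_
  have hlog : 0 ≤ Real.log (Bθ * Bl⁻¹ * Ll * n) := Real.log_nonneg hK0
  set L := Real.log (Bθ * Bl⁻¹ * Ll * n)
  set τ := 1 / δ * (Bl * q * L / n) with hτ
  set ε := loss f πstar T ω.2 (πhat ω.1)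
  have hε0 : 0 ≤ ε := loss_nonneg _ _ _ _ _
  have hτ0 : 0 ≤ τ := by positivity
  have hτα : τ * (μ / α) ^ (1 / (1 + r)) ≤ 1 := by
    have : 1 / δ * (Bl * ((q : ℝ) * (μ / α) ^ (1 / (1 + r))) * L / n) =
        τ * (μ / α) ^ (1 / (1 + r)) := by rw [hτ]; ring
    rw [this] at hrateα
    have : 0 ≤ τ * (μ / α) ^ (1 / (1 + r)) := by positivity
    linarith
  have hτη : 4 * (Lπ * μ * τ) ≤ η := by
    have : 1 / δ * (Bl * ((q : ℝ) * Lπ * μ / η) * L / n) = Lπ * μ * τ / η := by rw [hτ]; ring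
    rw [this, ← mul_div_assoc, div_le_one hη] at hrateη
    exact hrateη
  have hετ : ε ^ (1 + r) ≤ τ ^ (1 + r) := Real.rpow_le_rpow hε0 hle hp.le
  have hτp : τ ^ (1 + r) * (μ / α) ≤ 1 := by
    have h1 := Real.rpow_le_rpow (by positivity) hτα hp.le
    rwa [Real.mul_rpow hτ0 (by positivity), ← Real.rpow_mul (by positivity),
      one_div_mul_cancel hp.ne', Real.rpow_one, Real.one_rpow] at h1
  have hεα : μ * ε ^ (1 + r) ≤ α := by
    have h1 : μ * τ ^ (1 + r) ≤ α := by
      rw [← mul_div_assoc, div_le_one hα] at hτp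
      linarith
    exact (mul_le_mul_of_nonneg_left hετ hμ.le).trans h1
  -- From `μ * ε ^ (1 + r) ≤ α ≤ μ`.
  have hε1 : ε ≤ 1 := by
    have h1 : ε ^ (1 + r) ≤ 1 := by
      rw [div_le_one hμ] at hαμ
      exact le_of_mul_le_mul_left (by linarith) hμ
    by_contra! h
    exact absurd h1 (not_le.2 (Real.one_lt_rpow h hp))
  have hεp : ε ^ (1 + r) ≤ ε := by
    rcases hε0.eq_or_lt with h | h
    · rw [← h, Real.zero_rpow hp.ne']
    · simpa using Real.rpow_le_rpow_of_exponent_ge h hε1 (show 1 ≤ 1 + r by linarith)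
  -- Both summands are at most `2 Lπ μ ε`: the first as `ε ^ (1 + r) ≤ ε`, the second as `Lπ μ ≥ 1 /
  -- 2`. Hence the factor `4` in `hτη`.
  have hεη : 2 * Lπ * (μ * ε ^ (1 + r)) + ε ≤ η := by
    have hLμ : 0 ≤ Lπ * μ := by positivity
    have h1 := mul_le_mul_of_nonneg_left hεp hLμ
    have h2 := mul_le_mul_of_nonneg_right hLπμ hε0
    have h3 := mul_le_mul_of_nonneg_left hle hLμ
    linarith
  refine (imitationGap_le hISS hLπ (hpolLip _ hstar) (hpolLip _ hω.1) hμ hp hinv hωX hεα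
    hεη).trans ?_
  rw [one_mul]
  exact mul_le_mul_of_nonneg_left hετ hμ.le
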